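/- An mm-space is a triple $X=(X,d_X,\mu_X)$ where $(X,d_X)$ is a complete separable metric space and $\mu_X$ is a Borel probability measure on $X$. An mm-space $Y$ dominates $X$, written $Y\succ X$, if there is a $1$-Lipschitz map $F:Y\to X$ with $F_*\mu_Y=\mu_X$. Let $n\in\mathbb N\cup\{\infty\}$, let $\mathbb N_n=\{i\in\mathbb N : 1\le i\le n\}$ (so $\mathbb N_\infty=\{1,2,\dots\}$), and let $\alpha=(\alpha_i)_{i\in\mathbb N_n}$ be a family of positive real numbers. For an mm-space $X$ let $D_X(\alpha)$ be the set of families $(A_i)_{i\in\mathbb N_n}$ of pairwise disjoint Borel subsets of $X$ with $\mu_X(A_i)\ge\alpha_i$ for all $i\in\mathbb N_n$, and define, with values in $[0,\infty]$, \[ \operatorname{diam}(X;\alpha)=\inf\Big\{\sup_{i\in\mathbb N_n}\operatorname{diam}A_i \;\Big|\; (A_i)_{i\in\mathbb N_n}\in D_X(\alpha)\Big\}\qquad(\inf\emptyset=\infty), \] \[ \underline{\operatorname{diam}}(X;\alpha)=\inf_{Y\succ X}\operatorname{diam}(Y;\alpha), \] \[ \underline{\operatorname{Obsdiam}}(X;\alpha)=\sup\big\{\underline{\operatorname{diam}}\big((\mathbb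 R,|\cdot|,f_*\mu_X);\alpha\big)\;\big|\; f:X\to\mathbb R \text{ is } 1\text{-Lipschitz}\big\}. \] Then, for every mm-space $X$ and every such $\alpha$, the following four conditions are equivalent: 1. there exist an mm-space $Y$ with $Y\succ X$ and pairwise distinct points $y_i\in Y$ ($i\in\mathbb N_n$) such that $\mu_Y(\{y_i\})\ge\alpha_i$ for every $i\in\mathbb N_n$; 2. there exist (not necessarily distinct) points $x_i\in X$ ($i\in\mathbb N_n$) such that $\mu_X(\{x_i\mid i\in I\})\ge\sum_{i\in I}\alpha_i$ for every subset $I\subset\mathbb N_n$; 3. $\underline{\operatorname{diam}}(X;\alpha)=0$; 4. $\underline{\operatorname{Obsdiam}}(X;\alpha)=0$. -/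

import Mathlib

open MeasureTheory
open scoped ENNReal

universe u v w

/-- An mm-space: a complete separable metric space with a Borel probability measure. -/
structure MMSpace : Type (u + 1) where
  carrier : Type u
  [metricSpace : MetricSpace carrier]
  [completeSpace : CompleteSpace carrier]
  [separableSpace : TopologicalSpace.SeparableSpace carrier]
  [measurableSpace : MeasurableSpace carrier]
  [borelSpace : BorelSpace carrier]
  μ : Measure carrier
  [isProbabilityMeasure : IsProbabilityMeasure μ]

namespace MMSpace

instance : CoeSort MMSpace.{u} (Type u) := ⟨MMSpace.carrier⟩

attribute [instance] MMSpace.metricSpace MMSpace.completeSpace MMSpace.separableSpace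
  MMSpace.measurableSpace MMSpace.borelSpace MMSpace.isProbabilityMeasure

/-- `Y.Dominates X` is the Lipschitz order `Y ≻ X`. -/
def Dominates (Y : MMSpace.{u}) (X : MMSpace.{v}) : Prop :=
  ∃ F : Y → X, LipschitzWith 1 F ∧ Measure.map F Y.μ = X.μ

/-- The families of pairwise disjoint Borel subsets `A i` of `X` with `μ_X (A i) ≥ α i`. -/
def partialFamilies (X : MMSpace.{u}) {ι : Type w} (α : ι → ℝ) : Set (ι → Set X) :=
  {A | (∀ i, MeasurableSet (A i)) ∧ Pairwise (fun i j => Disjoint (A i) (A j)) ∧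
    ∀ i, ENNReal.ofReal (α i) ≤ X.μ (A i)}

/-- `diam(X; α)`; it is `∞` if there is no admissible family. -/
noncomputable def partialDiam (X : MMSpace.{u}) {ι : Type w} (α : ι → ℝ) : ℝ≥0∞ :=
  ⨅ A ∈ X.partialFamilies α, ⨆ i, Metric.ediam (A i)

/-- The infimum of `diam(Y; α)` over all mm-spaces `Y` dominating `X`. -/
noncomputable def udiam (X : MMSpace.{u}) {ι : Type w} (α : ι → ℝ) : ℝ≥0∞ :=
  ⨅ (Y : MMSpace.{u}) (_ : Y.Dominates X), Y.partialDiam α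

/-- The mm-space `(ℝ, f_* μ_X)` for a 1-Lipschitz function `f` on `X`. -/
noncomputable def pushReal (X : MMSpace.{u}) (f : X → ℝ) (hf : LipschitzWith 1 f) :
    MMSpace.{0} where
  carrier := ℝ
  μ := Measure.map f X.μ
  isProbabilityMeasure :=
    Measure.isProbabilityMeasure_map hf.continuous.measurable.aemeasurable

/-- The supremum of `udiam((ℝ, f_* μ_X); α)` over all 1-Lipschitz functions `f : X → ℝ`. -/
noncomputable def uObsdiam (X : MMSpace.{u}) {ι : Type w} (α : ι → ℝ) : ℝ≥0∞ :=
  ⨆ (f : X → ℝ) (hf : LipschitzWith 1 f), (X.pushReal f hf).udiam α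

end MMSpace

/-- The index set `ℕ ∩ [1, n]` for `n ∈ ℕ ∪ {∞}`. -/
abbrev NatUpTo (n : ℕ∞) : Type := {i : ℕ // 1 ≤ i ∧ (i : ℕ∞) ≤ n}

open Filter Topology

/-! ### A Lipschitz function separating almost all pairs of distinct points -/

/-! Everything passes through condition 2 (`CarriesWeights`). From 2, the atoms of `X` can be split
among copies of `X` in `X × ℕ`, which gives 1 and hence 3; since 2 survives 1-Lipschitz push-forward
to `ℝ`, it also gives 4. From 3, arbitrarily small sets jointly carry the weights; tightness makes
them accumulate at points `x i`, and the joint mass bounds pass to the limit. For 4 → 2, one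
well-chosen `f : X → ℝ` suffices: if `f` separates almost every pair of distinct points, each atom
of the push-forward comes from a single atom of `X`. Such an `f` is a generic member of a family of
power series in a parameter `s`, whose coefficients are distance functions to a dense sequence. -/

/-- The zeros in the unit interval of a nonzero power series with bounded coefficients form a
Lebesgue null set. -/
theorem volume_zeros_powerSeries {c : ℕ → ℝ} (hc : ∀ k, |c k| ≤ 1) (hc0 : c ≠ 0) :
    volume {s : ℝ | s ∈ Metric.ball (0 : ℝ) 1 ∧ ∑' k, s ^ k * c k = 0} = 0 := by
  set p := FormalMultilinearSeries.ofScalars ℝ c with hp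
  have hr : (1 : ℝ≥0∞) ≤ p.radius := by
    have := p.le_radius_of_bound 1 (r := 1) fun n => by
      rw [hp, FormalMultilinearSeries.ofScalars_norm]
      simpa using hc n
    simpa using this
  have hsum : HasFPowerSeriesOnBall p.sum p 0 p.radius :=
    p.hasFPowerSeriesOnBall (lt_of_lt_of_le one_pos hr)
  have hps : ∀ s, p.sum s = ∑' k, s ^ k * c k := fun s => by
    have := FormalMultilinearSeries.ofScalars_sum_eq (𝕜 := ℝ) (E := ℝ) c s
    rw [FormalMultilinearSeries.ofScalarsSum] at this
    rw [hp, this]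
    exact tsum_congr fun k => by simp [mul_comm]
  have han : AnalyticOnNhd ℝ p.sum (Metric.ball (0 : ℝ) 1) := by
    refine hsum.analyticOnNhd.mono fun s hs => ?_
    refine Metric.eball_subset_eball hr ?_
    rwa [← ENNReal.ofReal_one, Metric.eball_ofReal]
  refine measure_null_of_locally_null _ fun z hz => ?_
  -- Either zeros accumulate at `z` and the identity theorem kills every coefficient, or `z` is an
  -- isolated zero.
  by_cases hfreq : ∃ᶠ w in 𝓝[≠] z, p.sum w = 0
  · have h := han.eqOn_zero_of_preconnected_of_frequently_eq_zero
      (convex_ball (0 : ℝ) 1).isPreconnected hz.1 hfreq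
    refine absurd ?_ hc0
    have hev : ∀ᶠ z in 𝓝 (0 : ℝ), p.sum z = 0 :=
      Filter.mem_of_superset (Metric.ball_mem_nhds (0 : ℝ) one_pos) h
    exact FormalMultilinearSeries.ofScalars_series_eq_zero ℝ |>.1
      (hsum.hasFPowerSeriesAt.locally_zero_iff.1 hev)
  · refine ⟨{z}, ?_, measure_singleton z⟩
    filter_upwards [mem_nhdsWithin_of_mem_nhds (eventually_nhdsWithin_iff.1 (not_frequently.1 hfreq)),
      self_mem_nhdsWithin] with s hs hs'
    by_contra hsz
    exact hs hsz ((hps s).trans hs'.2)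

/-- For an s-finite measure there is a 1-Lipschitz function with `f x ≠ f y` for almost every pair of
distinct points. -/
theorem exists_lipschitz_ae_separating {X : Type*} [MetricSpace X]
    [TopologicalSpace.SeparableSpace X] [MeasurableSpace X] [BorelSpace X] (μ : Measure X)
    [SFinite μ] :
    ∃ f : X → ℝ, LipschitzWith 1 f ∧ ∀ᵐ x ∂μ, ∀ᵐ y ∂μ, f x = f y → x = y := by
  rcases isEmpty_or_nonempty X with hX | hX
  · exact ⟨fun _ => 0, LipschitzWith.of_dist_le_mul fun x => hX.elim x,
      Filter.Eventually.of_forall fun x => hX.elim x⟩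
  have : SecondCountableTopology X := UniformSpace.secondCountable_of_separable X
  -- The factor `1 / 2` offsets `∑ (1 / 2) ^ k = 2`, so the series below is 1-Lipschitz.
  set g : ℕ → X → ℝ := fun k x => min (dist x (TopologicalSpace.denseSeq X k)) 1 / 2 with hg
  have hg0 : ∀ k x, 0 ≤ g k x := fun k x => by positivity
  have hg1 : ∀ k x, g k x ≤ 1 / 2 := fun k x => by
    have := min_le_right (dist x (TopologicalSpace.denseSeq X k)) 1
    simp only [hg]; linarith
  have hgc : ∀ k, Continuous (g k) := fun k => by fun_prop
  have hgl : ∀ k x y, |g k x - g k y| ≤ dist x y / 2 := fun k x y => by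
    have h1 := abs_min_sub_min_le_max (dist x (TopologicalSpace.denseSeq X k)) 1
      (dist y (TopologicalSpace.denseSeq X k)) 1
    have h2 := abs_dist_sub_le x y (TopologicalSpace.denseSeq X k)
    have h3 : g k x - g k y = (min (dist x (TopologicalSpace.denseSeq X k)) 1 -
      min (dist y (TopologicalSpace.denseSeq X k)) 1) / 2 := by simp only [hg]; ring
    rw [h3, abs_div, abs_two]
    rw [sub_self, abs_zero, max_eq_left (abs_nonneg _)] at h1
    linarith
  have hgs : ∀ x y, (∀ k, g k x = g k y) → x = y := fun x y h => by
    by_contra hne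
    have hd : 0 < dist x y := dist_pos.2 hne
    obtain ⟨k, hk⟩ := (TopologicalSpace.denseRange_denseSeq X).exists_dist_lt x
      (lt_min (half_pos hd) (half_pos one_pos))
    have h1 := h k
    obtain ⟨hk1, hk2⟩ := lt_min_iff.1 hk
    have h2 : dist x (TopologicalSpace.denseSeq X k) < dist y (TopologicalSpace.denseSeq X k) := by
      have := dist_triangle_right x y (TopologicalSpace.denseSeq X k)
      linarith
    have h3 : dist x (TopologicalSpace.denseSeq X k) <
      min (dist y (TopologicalSpace.denseSeq X k)) 1 := lt_min h2 (by linarith)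
    have h4 := min_le_left (dist x (TopologicalSpace.denseSeq X k)) 1
    simp only [hg] at h1
    linarith
  -- Clamping makes the series converge uniformly for all real `s`; only `s` in `(0, 1 / 2)`, where
  -- `cl s = s`, matters.
  set cl : ℝ → ℝ := fun s => max 0 (min s (1 / 2)) with hcl
  have hcl0 : ∀ s, 0 ≤ cl s := fun s => le_max_left _ _
  have hcl1 : ∀ s, cl s ≤ 1 / 2 := fun s => max_le (by norm_num) (min_le_right _ _)
  set F : ℝ → X → ℝ := fun s x => ∑' k, cl s ^ k * g k x with hF
  have hgeo : Summable fun k : ℕ => ((1 : ℝ) / 2) ^ k := summable_geometric_two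
  have hbd : ∀ k s x, ‖cl s ^ k * g k x‖ ≤ (1 / 2) ^ k := fun k s x => by
    rw [Real.norm_eq_abs, abs_of_nonneg (mul_nonneg (pow_nonneg (hcl0 s) k) (hg0 k x))]
    calc cl s ^ k * g k x ≤ (1 / 2) ^ k * 1 :=
          mul_le_mul (pow_le_pow_left₀ (hcl0 s) (hcl1 s) k) ((hg1 k x).trans (by norm_num))
            (hg0 k x) (by positivity)
      _ = _ := mul_one _
  have hsm : ∀ s x, Summable fun k => cl s ^ k * g k x := fun s x =>
    Summable.of_norm_bounded hgeo fun k => hbd k s x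
  have hFc : Continuous fun q : ℝ × X => F q.1 q.2 :=
    continuous_tsum (fun k => by fun_prop) hgeo fun k q => hbd k q.1 q.2
  have hsub : ∀ s x y, F s x - F s y = ∑' k, cl s ^ k * (g k x - g k y) := fun s x y => by
    rw [hF, ← (hsm s x).tsum_sub (hsm s y)]
    exact tsum_congr fun k => by ring
  have hlip : ∀ s, LipschitzWith 1 (F s) := fun s => by
    refine LipschitzWith.of_dist_le_mul fun x y => ?_
    rw [Real.dist_eq, hsub, NNReal.coe_one, one_mul]
    have hs : HasSum (fun k : ℕ => ((1 : ℝ) / 2) ^ k * (dist x y / 2)) (dist x y) := by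
      have := hasSum_geometric_two.mul_right (dist x y / 2)
      rwa [show (2 : ℝ) * (dist x y / 2) = dist x y by ring] at this
    rw [← Real.norm_eq_abs]
    refine tsum_of_norm_bounded hs fun k => ?_
    rw [norm_mul, Real.norm_eq_abs, Real.norm_eq_abs, abs_of_nonneg (pow_nonneg (hcl0 s) k)]
    exact mul_le_mul (pow_le_pow_left₀ (hcl0 s) (hcl1 s) k) (hgl k x y) (abs_nonneg _)
      (by positivity)
  set ν : Measure ℝ := volume.restrict (Set.Ioo 0 (1 / 2)) with hν
  have hsep : ∀ x y, ∀ᵐ s ∂ν, F s x = F s y → x = y := fun x y => by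
    by_cases hxy : x = y
    · exact Filter.Eventually.of_forall fun _ _ => hxy
    have hz := volume_zeros_powerSeries (c := fun k => g k x - g k y)
      (fun k => abs_le.2 ⟨by linarith [hg0 k x, hg1 k y], by linarith [hg0 k y, hg1 k x]⟩)
      (fun h => hxy (hgs x y fun k => sub_eq_zero.1 (congrFun h k)))
    rw [hν, ae_restrict_iff' measurableSet_Ioo]
    have hz' := measure_eq_zero_iff_ae_notMem.1 hz
    filter_upwards [hz'] with s hs hs' hfs
    refine absurd ⟨?_, ?_⟩ hs
    · rw [mem_ball_zero_iff, Real.norm_eq_abs, abs_of_pos hs'.1]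
      linarith [hs'.2]
    · have : cl s = s := by
        simp only [hcl]
        rw [min_eq_left hs'.2.le, max_eq_right hs'.1.le]
      rw [← this, ← hsub, hfs, sub_self]
  have hmeas : MeasurableSet {q : (X × X) × ℝ | F q.2 q.1.1 = F q.2 q.1.2 → q.1.1 = q.1.2} := by
    have h1 : IsClosed {q : (X × X) × ℝ | F q.2 q.1.1 = F q.2 q.1.2} :=
      isClosed_eq (hFc.comp (by fun_prop : Continuous fun q : (X × X) × ℝ => (q.2, q.1.1)))
        (hFc.comp (by fun_prop : Continuous fun q : (X × X) × ℝ => (q.2, q.1.2)))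
    have h2 : IsClosed {q : (X × X) × ℝ | q.1.1 = q.1.2} :=
      isClosed_eq (by fun_prop) (by fun_prop)
    exact h1.measurableSet.imp h2.measurableSet
  -- Fubini: each pair is separated for almost every `s`, so almost every `s` separates almost every
  -- pair.
  have hae : ∀ᵐ s ∂ν, ∀ᵐ q ∂(μ.prod μ), F s q.1 = F s q.2 → q.1 = q.2 :=
    (Measure.ae_ae_comm (μ := μ.prod μ) (ν := ν)
      (p := fun q s => F s q.1 = F s q.2 → q.1 = q.2) hmeas).1
      (Filter.Eventually.of_forall fun q => hsep q.1 q.2)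
  have hν0 : NeBot (ae ν) := by
    rw [ae_neBot, hν, Ne, Measure.restrict_eq_zero, Real.volume_Ioo]
    norm_num
  obtain ⟨s, hs⟩ := hae.exists
  exact ⟨F s, hlip s, Measure.ae_ae_of_ae_prod hs⟩

namespace MMSpace

variable {ι : Type w}

/-! ### Splitting atoms -/

/-- The points `x i` carry the weights `α i` simultaneously: `μ_X {x i | i ∈ I}` is at
least the sum of `α i` over `I`, for every `I`. -/
def CarriesWeights (X : MMSpace.{u}) (α : ι → ℝ) (x : ι → X) : Prop :=
  ∀ I : Set ι, ∑' i : I, ENNReal.ofReal (α i) ≤ X.μ (x '' I)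

theorem CarriesWeights.sum_dirac_le [Countable ι] {X : MMSpace.{u}} {α : ι → ℝ} {x : ι → X}
    (hx : X.CarriesWeights α x) :
    Measure.sum (fun i => ENNReal.ofReal (α i) • Measure.dirac (x i)) ≤ X.μ := by
  refine Measure.le_iff.2 fun s hs => ?_
  calc Measure.sum (fun i => ENNReal.ofReal (α i) • Measure.dirac (x i)) s
      = ∑' i : (x ⁻¹' s : Set ι), ENNReal.ofReal (α i) := by
        rw [Measure.sum_apply _ hs, tsum_subtype (x ⁻¹' s) fun i => ENNReal.ofReal (α i)]
        refine tsum_congr fun i => ?_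
        by_cases hi : x i ∈ s <;> simp [hs, hi, Set.indicator]
    _ ≤ X.μ (x '' (x ⁻¹' s)) := hx _
    _ ≤ X.μ s := measure_mono (Set.image_preimage_subset _ _)

theorem CarriesWeights.exists_dominates [Countable ι] {X : MMSpace.{u}} {α : ι → ℝ} {x : ι → X}
    (hx : X.CarriesWeights α x) :
    ∃ Y : MMSpace.{u}, Y.Dominates X ∧
      ∃ y : ι → Y, Function.Injective y ∧ ∀ i, ENNReal.ofReal (α i) ≤ Y.μ {y i} := by
  obtain ⟨e, he⟩ := exists_injective_nat ι
  set σ : Measure X := Measure.sum (fun i => ENNReal.ofReal (α i) • Measure.dirac (x i)) with hσ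
  have hσle : σ ≤ X.μ := hx.sum_dirac_le
  have : IsFiniteMeasure σ := isFiniteMeasure_of_le X.μ hσle
  -- Level `0` is reserved for the residual mass `X.μ - σ`.
  let y : ι → X × ℕ := fun i => (x i, e i + 1)
  set τ : Measure (X × ℕ) := Measure.sum (fun i => ENNReal.ofReal (α i) • Measure.dirac (y i))
    with hτ
  set ν : Measure (X × ℕ) := (X.μ - σ).map (fun z => (z, 0)) + τ with hν
  have hmap : ν.map Prod.fst = X.μ := by
    have h1 : τ.map Prod.fst = σ := by
      rw [hτ, Measure.map_sum measurable_fst.aemeasurable, hσ]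
      congr 1
      funext i
      rw [Measure.map_smul, Measure.map_dirac' measurable_fst]
    rw [hν, Measure.map_add _ _ measurable_fst, h1,
      Measure.map_map measurable_fst (measurable_id'.prodMk measurable_const)]
    exact (congrArg (· + σ) Measure.map_id).trans (Measure.sub_add_cancel_of_le hσle)
  have hprob : IsProbabilityMeasure ν := ⟨by
    rw [← Set.preimage_univ (f := Prod.fst), ← Measure.map_apply measurable_fst .univ, hmap,
      measure_univ]⟩
  refine ⟨{ carrier := X × ℕ, μ := ν }, ⟨Prod.fst, LipschitzWith.prod_fst, hmap⟩, y,
    fun i j h => he (Nat.succ_injective (congrArg Prod.snd h)), fun i => ?_⟩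
  calc ENNReal.ofReal (α i) = (ENNReal.ofReal (α i) • Measure.dirac (y i)) {y i} := by simp
    _ ≤ τ {y i} := Measure.le_sum _ i _
    _ ≤ ν {y i} := Measure.le_add_left le_rfl _

theorem udiam_eq_zero_of_dominates {X Y : MMSpace.{u}} {α : ι → ℝ} (hYX : Y.Dominates X)
    {y : ι → Y} (hy : Function.Injective y) (hα : ∀ i, ENNReal.ofReal (α i) ≤ Y.μ {y i}) :
    X.udiam α = 0 := by
  refine le_antisymm (iInf₂_le_of_le Y hYX (iInf₂_le_of_le (fun i => {y i}) ?_ ?_)) zero_le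
  · exact ⟨fun i => measurableSet_singleton _,
      fun i j hij => Set.disjoint_singleton.2 fun h => hij (hy h), hα⟩
  · simp

theorem CarriesWeights.udiam_eq_zero [Countable ι] {X : MMSpace.{u}} {α : ι → ℝ} {x : ι → X}
    (hx : X.CarriesWeights α x) : X.udiam α = 0 := by
  obtain ⟨Y, hYX, y, hy, hα⟩ := hx.exists_dominates
  exact udiam_eq_zero_of_dominates hYX hy hα

theorem CarriesWeights.pushReal [Countable ι] {X : MMSpace.{u}} {α : ι → ℝ} {x : ι → X}
    (hx : X.CarriesWeights α x) {f : X → ℝ} (hf : LipschitzWith 1 f) :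
    (X.pushReal f hf).CarriesWeights α (f ∘ x) := fun I => by
  have hc : ((f ∘ x) '' I).Countable := I.to_countable.image _
  refine (hx I).trans ?_
  change _ ≤ Measure.map f X.μ ((f ∘ x) '' I)
  rw [Measure.map_apply hf.continuous.measurable hc.measurableSet]
  exact measure_mono (Set.image_subset_iff.2 fun i hi => ⟨i, hi, rfl⟩)

theorem CarriesWeights.uObsdiam_eq_zero [Countable ι] {X : MMSpace.{u}} {α : ι → ℝ} {x : ι → X}
    (hx : X.CarriesWeights α x) : X.uObsdiam α = 0 := by
  simp only [uObsdiam, ENNReal.iSup_eq_zero]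
  exact fun f hf => (hx.pushReal hf).udiam_eq_zero

/-! ### Vanishing diameter gives atoms -/

/-- If `udiam` vanishes, there are arbitrarily small sets carrying the weights `α` jointly. -/
theorem exists_small_sets_of_udiam_eq_zero {X : MMSpace.{u}} {α : ι → ℝ} (h : X.udiam α = 0)
    {ε : ℝ≥0∞} (hε : 0 < ε) :
    ∃ B : ι → Set X, (∀ i, Metric.ediam (B i) ≤ ε) ∧ ∀ (C : Set X) (J : Finset ι),
      MeasurableSet C → (∀ i ∈ J, B i ⊆ C) → ∑ i ∈ J, ENNReal.ofReal (α i) ≤ X.μ C := by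
  have h' : X.udiam α < ε := h ▸ hε
  simp only [udiam, partialDiam, iInf_lt_iff] at h'
  obtain ⟨Y, ⟨F, hF, hFμ⟩, A, ⟨hAm, hAd, hAα⟩, hA⟩ := h'
  -- The images need be neither measurable nor disjoint, so mass is bounded on measurable supersets
  -- `C`, using disjointness upstairs.
  refine ⟨fun i => F '' A i, fun i => ?_, fun C J hC hJ => ?_⟩
  · have := hF.ediam_image_le (A i)
    rw [ENNReal.coe_one, one_mul] at this
    exact this.trans ((le_iSup (fun i => Metric.ediam (A i)) i).trans hA.le)
  · calc ∑ i ∈ J, ENNReal.ofReal (α i) ≤ ∑ i ∈ J, Y.μ (A i) := Finset.sum_le_sum fun i _ => hAα i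
      _ = Y.μ (⋃ i ∈ J, A i) :=
        (measure_biUnion_finset (fun i _ j _ hij => hAd hij) fun i _ => hAm i).symm
      _ ≤ Y.μ (F ⁻¹' C) := measure_mono (Set.iUnion₂_subset fun i hi =>
        Set.image_subset_iff.1 (hJ i hi))
      _ = X.μ C := by rw [← hFμ, Measure.map_apply hF.continuous.measurable hC]

theorem exists_carriesWeights_of_udiam_eq_zero {X : MMSpace.{u}} {α : ι → ℝ}
    (hα : ∀ i, 0 < α i) (h : X.udiam α = 0) : ∃ x : ι → X, X.CarriesWeights α x := by
  have : SecondCountableTopology X := UniformSpace.secondCountable_of_separable X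
  choose B hBd hB using fun k : ℕ => exists_small_sets_of_udiam_eq_zero h
    (ε := ENNReal.ofReal (1 / (k + 1))) (ENNReal.ofReal_pos.2 (by positivity))
  -- The complement of `K i` is too light to contain `B k i`, so every `B k i` meets the fixed
  -- compact set `K i`.
  have hK : ∀ i, ∃ K : Set X, IsCompact K ∧ X.μ Kᶜ < ENNReal.ofReal (α i) := fun i => by
    obtain ⟨K, -, hK, hlt⟩ := MeasurableSet.univ.exists_isCompact_sdiff_lt (μ := X.μ)
      (measure_ne_top _ _) (ENNReal.ofReal_pos.2 (hα i)).ne'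
    exact ⟨K, hK, by rwa [Set.compl_eq_univ_sdiff]⟩
  choose K hKc hKlt using hK
  have hne : ∀ k i, ∃ z, z ∈ B k i ∧ z ∈ K i := fun k i => by
    by_contra! hcon
    have := hB k (K i)ᶜ {i} (hKc i).measurableSet.compl fun j hj => by
      rw [Finset.mem_singleton.1 hj]
      exact hcon
    rw [Finset.sum_singleton] at this
    exact absurd (hKlt i) this.not_gt
  choose z hzB hzK using hne
  -- One ultrafilter gives limits for all `i` at once, without a diagonal subsequence.
  have hlim : ∀ i, ∃ x, Tendsto (fun k => z k i) (hyperfilter ℕ : Filter ℕ) (𝓝 x) := fun i => by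
    obtain ⟨x, -, hx⟩ := (hKc i).ultrafilter_le_nhds ((hyperfilter ℕ).map fun k => z k i)
      (le_principal_iff.2 (Filter.mem_map.2 (Filter.univ_mem' fun k => hzK k i)))
    exact ⟨x, hx⟩
  choose x hx using hlim
  -- Finiteness of `J` gives a `k` common to all indices and a closed image, whose mass is the limit
  -- of the masses of its thickenings.
  have hfin : ∀ J : Finset ι, ∑ i ∈ J, ENNReal.ofReal (α i) ≤ X.μ (x '' J) := fun J => by
    have hcl : IsClosed (x '' (J : Set ι)) := (J.finite_toSet.image x).isClosed
    have ht := tendsto_measure_cthickening_of_isClosed (μ := X.μ)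
      ⟨1, one_pos, measure_ne_top _ _⟩ hcl
    refine ge_of_tendsto (ht.mono_left (nhdsWithin_le_nhds (s := Set.Ioi 0))) ?_
    filter_upwards [self_mem_nhdsWithin] with ε hε
    have hε2 : 0 < ε / 2 := half_pos hε
    have h1 : ∀ᶠ k in (hyperfilter ℕ : Filter ℕ), ∀ i ∈ J, dist (z k i) (x i) < ε / 2 :=
      (J.eventually_all).2 fun i _ => (hx i).eventually (Metric.ball_mem_nhds _ hε2)
    have h2 : ∀ᶠ k : ℕ in (hyperfilter ℕ : Filter ℕ), 1 / ((k : ℝ) + 1) < ε / 2 :=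
      (tendsto_one_div_add_atTop_nhds_zero_nat.eventually_lt_const hε2).filter_mono
        Nat.hyperfilter_le_atTop
    obtain ⟨k, hk1, hk2⟩ := (h1.and h2).exists
    refine hB k _ J Metric.isClosed_cthickening.measurableSet fun i hi b hb => ?_
    refine Metric.mem_cthickening_of_dist_le b (x i) ε _ ⟨i, hi, rfl⟩ ?_
    have h3 : edist b (z k i) ≤ ENNReal.ofReal (1 / (k + 1)) :=
      (Metric.edist_le_ediam_of_mem hb (hzB k i)).trans (hBd k i)
    rw [edist_dist, ENNReal.ofReal_le_ofReal_iff (by positivity)] at h3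
    linarith [dist_triangle b (z k i) (x i), hk1 i hi]
  refine ⟨x, fun I => ?_⟩
  rw [ENNReal.tsum_eq_iSup_sum]
  refine iSup_le fun J => ?_
  calc ∑ i ∈ J, ENNReal.ofReal (α i)
      = ∑ i ∈ J.map (Function.Embedding.subtype _), ENNReal.ofReal (α i) := by
        rw [Finset.sum_map]; rfl
    _ ≤ X.μ (x '' (J.map (Function.Embedding.subtype _) : Finset ι)) := hfin _
    _ ≤ X.μ (x '' I) := measure_mono (Set.image_mono fun i hi => by
        obtain ⟨j, -, rfl⟩ := Finset.mem_map.1 (Finset.mem_coe.1 hi)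
        exact j.2)

theorem exists_carriesWeights_of_uObsdiam_eq_zero [Countable ι] {X : MMSpace.{u}} {α : ι → ℝ}
    (hα : ∀ i, 0 < α i) (h : X.uObsdiam α = 0) : ∃ x : ι → X, X.CarriesWeights α x := by
  obtain ⟨f, hf, hsep⟩ := exists_lipschitz_ae_separating X.μ
  simp only [uObsdiam, ENNReal.iSup_eq_zero] at h
  obtain ⟨t, ht⟩ : ∃ t : ι → ℝ, (X.pushReal f hf).CarriesWeights α t :=
    exists_carriesWeights_of_udiam_eq_zero hα (h f hf)
  have ht' : ∀ I : Set ι, ∑' i : I, ENNReal.ofReal (α i) ≤ X.μ (f ⁻¹' (t '' I)) := fun I => by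
    rw [← Measure.map_apply hf.continuous.measurable (I.to_countable.image t).measurableSet]
    exact ht I
  -- The fibre has positive mass, so it contains a point that `f` separates from almost every other
  -- point; the rest of the fibre is null.
  have hatom : ∀ i, ∃ x : X, X.μ (f ⁻¹' {t i} \ {x}) = 0 := fun i => by
    have hpos : X.μ (f ⁻¹' {t i}) ≠ 0 := fun h0 => by
      have := ht' {i}
      rw [Set.image_singleton, h0, tsum_singleton i fun i => ENNReal.ofReal (α i)] at this
      exact absurd this (ENNReal.ofReal_pos.2 (hα i)).not_ge
    obtain ⟨x, hxt, hx⟩ := (frequently_ae_mem_iff.2 hpos).and_eventually hsep |>.exists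
    refine ⟨x, measure_mono_null (fun y hy => ?_) hx⟩
    exact fun hcon => hy.2 (hcon (Eq.trans hxt (Eq.symm hy.1))).symm
  choose x hx using hatom
  refine ⟨x, fun I => (ht' I).trans ?_⟩
  have hnull : X.μ (⋃ i, f ⁻¹' {t i} \ {x i}) = 0 := measure_iUnion_null hx
  calc X.μ (f ⁻¹' (t '' I)) ≤ X.μ (x '' I ∪ ⋃ i, f ⁻¹' {t i} \ {x i}) := measure_mono (by
        rintro y ⟨i, hi, hy⟩
        by_cases hyx : y = x i
        · exact Or.inl ⟨i, hi, hyx.symm⟩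
        · exact Or.inr (Set.mem_iUnion.2 ⟨i, hy.symm, hyx⟩))
    _ ≤ X.μ (x '' I) + 0 := hnull ▸ measure_union_le _ _
    _ = X.μ (x '' I) := add_zero _

end MMSpace

theorem theorem2 (X : MMSpace.{u}) (n : ℕ∞) (α : NatUpTo n → ℝ) (hα : ∀ i, 0 < α i) :
    List.TFAE [
      ∃ Y : MMSpace.{u}, Y.Dominates X ∧
        ∃ y : NatUpTo n → Y, Function.Injective y ∧ ∀ i, ENNReal.ofReal (α i) ≤ Y.μ {y i},
      ∃ x : NatUpTo n → X, ∀ I : Set (NatUpTo n),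
        ∑' i : I, ENNReal.ofReal (α i) ≤ X.μ (x '' I),
      X.udiam α = 0,
      X.uObsdiam α = 0] := by
  tfae_have 1 → 3
  | ⟨_, hYX, _, hy, hyα⟩ => MMSpace.udiam_eq_zero_of_dominates hYX hy hyα
  tfae_have 3 → 2 := MMSpace.exists_carriesWeights_of_udiam_eq_zero hα
  tfae_have 2 → 1
  | ⟨_, hx⟩ => MMSpace.CarriesWeights.exists_dominates hx
  tfae_have 2 → 4
  | ⟨_, hx⟩ => MMSpace.CarriesWeights.uObsdiam_eq_zero hx
  tfae_have 4 → 2 := MMSpace.exists_carriesWeights_of_uObsdiam_eq_zero hα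
  tfae_finish
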